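/- **Fixed-precision transformers.** For integers $p\ge 1$ and $0\le s\le p$ let $\mathbb F=\mathbb F_{p,s}$ be the set of numbers $m2^{-s}$ with $m\in\mathbb Z$, $-2^{p-1}\le m<2^{p-1}$. For real $x$ let $\mathrm{round}(x)$ be the greatest element of $\mathbb F$ that is $\le x$ (and $\min\mathbb F$ if there is none). A (future-masked) fixed-precision transformer $T$ over a finite nonempty alphabet $\Sigma$, with precision $p$ (and some number $s\le p$ of fractional bits), dimension $d$ and depth $L$, is given by arbitrary functions $E:\Sigma\to\mathbb F^d$, $W_Q^{(\ell)},W_K^{(\ell)},W_V^{(\ell)},f^{(\ell)}:\mathbb F^d\to\mathbb F^d$ $(1\le\ell\le L)$ and $W_{\rm out}:\mathbb F^d\to\mathbb F$. On a nonempty string $w=w_1\cdots w_n$ put $h_i^{(0)}=E(w_i)$ and, for $\ell=1,\dots,L$, with $q_i,k_i,v_i$ the images of $h_i^{(\ell-1)}$ under $W_Q^{(\ell)},W_K^{(\ell)},W_V^{(\ell)}$, $$A_{ij}=\mathrm{round}(\exp(q_i\cdot k_j)),\qquad B_i=\sum_{j\le i}A_{ij},\qquad \alpha_{ij}=\mathrm{round}(A_{ij}/B_i),$$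 $$c_i=\mathrm{round}\Bigl(\sum_{j\le i}\alpha_{ij}v_j\Bigr),\qquad h_i^{(\ell)}=f^{(\ell)}\bigl(\mathrm{round}(c_i+h_i^{(\ell-1)})\bigr),$$ where $A_{ij}/B_i$ is read as $1/i$ if $B_i=0$, and vectors are rounded componentwise. $T$ accepts $w$ if $W_{\rm out}(h_n^{(L)})>0$. The language of $T$ is either (i) the set of nonempty strings $w\in\Sigma^*$ that $T$ accepts, or (ii), for a transformer over $\Sigma\cup\{\texttt{<BOS>}\}$, the set of all $w\in\Sigma^*$ such that $T$ accepts $\texttt{<BOS>}\cdot w$. The theorem holds for both conventions. **Length complexity.** For a class $\mathcal C$ of transformers over the same alphabet, with languages $\mathcal L(T)$, the length complexity of $\mathcal C$ is the maximum, over all $T,T'\in\mathcal C$ with $\mathcal L(T)\setminus\mathcal L(T')\neq\emptyset$, of $\min\{|w|: w\in\mathcal L(T)\setminus\mathcal L(T')\}$ (it is $\infty$ if there is no finite maximum). **Theorem** (Fixed-precision transformers admit length generalization with exponential length complexity). There are a computable function $N:\mathbb N^3\to\mathbb N$ and a polynomial $Q$ in three variables with coefficients in $\mathbb N$, with $N(p,d,L)\le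 2^{Q(p,d,L)}$ for all $p,d,L$, such that for every finite nonempty alphabet $\Sigma$: 1. (Upper bound.) For all $p,d,L$ the length complexity of the class of fixed-precision transformers with precision at most $p$, dimension at most $d$ and depth at most $L$ is at most $N(p,d,L)\le 2^{Q(p,d,L)}$. 2. (Length generalization.) For all $p,d,L$, if $T$ and $T'$ belong to the class in 1 and agree on all strings of length at most $N(p,d,L)$, then $\mathcal L(T)=\mathcal L(T')$. So any learner that outputs a member of the class consistent with the target on all strings of length at most $N(p,d,L)$ has found the language of the target. 3. (Lower bound.) For all $p\ge2$, $d\ge1$, $L\ge1$ the length complexity of the class of fixed-precision transformers with precision exactly $p$, dimension exactly $d$ and depth exactly $L$ is at least $2^p$ (hence so is that of the class in 1). -/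

import Mathlib

universe u v

/-- The fixed-precision numbers with `p` total bits and `s` fractional bits: the numbers
`m * 2 ^ (-s)` with `m` an integer, `-2 ^ (p - 1) ≤ m < 2 ^ (p - 1)` (used for `1 ≤ p`). -/
abbrev FixedPrecision (p s : ℕ) : Type :=
  {x : ℝ // ∃ m : ℤ, -2 ^ (p - 1) ≤ m ∧ m < 2 ^ (p - 1) ∧ x = (m : ℝ) / 2 ^ s}

/-- Rounding down to a fixed-precision number, saturating at both ends of the range. -/
noncomputable def fpRound (p s : ℕ) (x : ℝ) : FixedPrecision p s :=
  ⟨((max (-2 ^ (p - 1)) (min ⌊x * 2 ^ s⌋ (2 ^ (p - 1) - 1)) : ℤ) : ℝ) / 2 ^ s,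
    max (-2 ^ (p - 1)) (min ⌊x * 2 ^ s⌋ (2 ^ (p - 1) - 1)), le_max_left _ _, by
      have h : (0 : ℤ) < 2 ^ (p - 1) := by positivity
      refine max_lt (by linarith) ((min_le_right _ _).trans_lt (by linarith)), rfl⟩

/-- `fpRound x` is the greatest fixed-precision number that is at most `x`, whenever there is
one (that is, unless `x` lies below the whole range). -/
theorem fpRound_isGreatest (p s : ℕ) (x : ℝ) (hx : -2 ^ (p - 1) / 2 ^ s ≤ x) :
    IsGreatest {y : FixedPrecision p s | (y : ℝ) ≤ x} (fpRound p s x) := by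
  have hs : (0 : ℝ) < 2 ^ s := by positivity
  constructor
  · have h1 : (-2 ^ (p - 1) : ℤ) ≤ ⌊x * 2 ^ s⌋ := by
      rw [Int.le_floor]
      push_cast
      rwa [div_le_iff₀ hs] at hx
    have h0 : (0 : ℤ) < 2 ^ (p - 1) := by positivity
    have h2 : max (-2 ^ (p - 1)) (min ⌊x * 2 ^ s⌋ (2 ^ (p - 1) - 1)) ≤ ⌊x * 2 ^ s⌋ :=
      max_le h1 (min_le_left _ _)
    change ((max (-2 ^ (p - 1)) (min ⌊x * 2 ^ s⌋ (2 ^ (p - 1) - 1)) : ℤ) : ℝ) / 2 ^ s ≤ x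
    rw [div_le_iff₀ hs]
    exact (Int.cast_le.mpr h2).trans (Int.floor_le _)
  · rintro ⟨y, m, hm1, hm2, rfl⟩ hy
    change (m : ℝ) / 2 ^ s ≤ x at hy
    rw [div_le_iff₀ hs] at hy
    have h3 : m ≤ max (-2 ^ (p - 1)) (min ⌊x * 2 ^ s⌋ (2 ^ (p - 1) - 1)) :=
      le_max_of_le_right (le_min (Int.le_floor.mpr hy) (by linarith))
    change (m : ℝ) / 2 ^ s ≤ ((max (-2 ^ (p - 1)) (min ⌊x * 2 ^ s⌋ (2 ^ (p - 1) - 1)) : ℤ) : ℝ) / 2 ^ s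
    exact div_le_div_of_nonneg_right (Int.cast_le.mpr h3) hs.le

/-- One layer: query, key and value maps of the self-attention, and a feed-forward map. -/
structure FPLayer (p s d : ℕ) where
  query : (Fin d → FixedPrecision p s) → (Fin d → FixedPrecision p s)
  key : (Fin d → FixedPrecision p s) → (Fin d → FixedPrecision p s)
  value : (Fin d → FixedPrecision p s) → (Fin d → FixedPrecision p s)
  feedForward : (Fin d → FixedPrecision p s) → (Fin d → FixedPrecision p s)

namespace FPLayer

variable {p s d n : ℕ}

/-- The rounded exponentiated attention logit `round (exp (qᵢ · kⱼ))`. -/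
noncomputable def expLogit (l : FPLayer p s d) (h : Fin n → Fin d → FixedPrecision p s)
    (i j : Fin n) : ℝ :=
  (fpRound p s (Real.exp (∑ c, (l.query (h i) c : ℝ) * (l.key (h j) c : ℝ))) : ℝ)

/-- The normalizer `∑_{j ≤ i} round (exp (qᵢ · kⱼ))`, computed exactly. -/
noncomputable def normalizer (l : FPLayer p s d) (h : Fin n → Fin d → FixedPrecision p s)
    (i : Fin n) : ℝ :=
  ∑ j ∈ Finset.Iic i, l.expLogit h i j

/-- The rounded attention weight of position `j` as seen from position `i`. If the normalizer
vanishes, attention is uniform over the visible positions (there are `i + 1` of them, positions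
being numbered from `0`). -/
noncomputable def weight (l : FPLayer p s d) (h : Fin n → Fin d → FixedPrecision p s)
    (i j : Fin n) : ℝ :=
  if l.normalizer h i = 0 then (fpRound p s (1 / ((i : ℕ) + 1 : ℝ)) : ℝ)
  else (fpRound p s (l.expLogit h i j / l.normalizer h i) : ℝ)

/-- The output of the (future-masked) attention at position `i`. -/
noncomputable def attention (l : FPLayer p s d) (h : Fin n → Fin d → FixedPrecision p s)
    (i : Fin n) : Fin d → FixedPrecision p s :=
  fun c => fpRound p s (∑ j ∈ Finset.Iic i, l.weight h i j * (l.value (h j) c : ℝ))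

/-- The activations after the layer; the residual sum is again a fixed-precision vector. -/
noncomputable def apply (l : FPLayer p s d) (h : Fin n → Fin d → FixedPrecision p s) :
    Fin n → Fin d → FixedPrecision p s :=
  fun i => l.feedForward fun c => fpRound p s ((l.attention h i c : ℝ) + (h i c : ℝ))

end FPLayer

/-- A (future-masked) fixed-precision transformer over the alphabet `α`. -/
structure FPTransformer (α : Type u) where
  precision : ℕ
  fracBits : ℕ
  dim : ℕ
  precision_pos : 1 ≤ precision
  fracBits_le : fracBits ≤ precision
  embed : α → Fin dim → FixedPrecision precision fracBits
  layers : List (FPLayer precision fracBits dim)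
  unembed : (Fin dim → FixedPrecision precision fracBits) → FixedPrecision precision fracBits

namespace FPTransformer

variable {α : Type u}

/-- The number of layers. -/
def depth (T : FPTransformer α) : ℕ := T.layers.length

/-- The activations at all positions of `x` after the last layer. -/
noncomputable def hidden (T : FPTransformer α) (x : List α) :
    Fin x.length → Fin T.dim → FixedPrecision T.precision T.fracBits :=
  T.layers.foldl (fun h l => l.apply h) (fun i => T.embed (x.get i))

/-- The output of the transformer, read off at the last position of a nonempty string. -/
noncomputable def output (T : FPTransformer α) (x : List α) (hx : x ≠ []) :
    FixedPrecision T.precision T.fracBits :=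
  T.unembed (T.hidden x ⟨x.length - 1, Nat.sub_lt (List.length_pos_of_ne_nil hx) Nat.one_pos⟩)

/-- The language of `T`: the (nonempty) strings on which the output is positive. -/
def language (T : FPTransformer α) : Set (List α) :=
  {x | ∃ hx : x ≠ [], 0 < (T.output x hx : ℝ)}

/-- The language over `α` of a transformer that is run with a beginning-of-string symbol
(`none`) in front of its input: all `x`, possibly empty, such that `<BOS> x` is accepted. -/
def bosLanguage (T : FPTransformer (Option α)) : Set (List α) :=
  {x | none :: x.map some ∈ T.language}

/-- Transformers of precision, dimension and depth at most `p`, `d`, `L`. -/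
def atMost (α : Type u) (p d L : ℕ) : Set (FPTransformer α) :=
  {T | T.precision ≤ p ∧ T.dim ≤ d ∧ T.depth ≤ L}

/-- Transformers of precision, dimension and depth exactly `p`, `d`, `L`. -/
def exactly (α : Type u) (p d L : ℕ) : Set (FPTransformer α) :=
  {T | T.precision = p ∧ T.dim = d ∧ T.depth = L}

end FPTransformer

/-- The length complexity of a set `C` of representations with respect to the map `lang` from
representations to languages: the maximum, over all `E, E'` in `C` such that
`lang E \ lang E'` is nonempty, of the minimal length of a string in `lang E \ lang E'`
(with value `⊤` if there is no finite maximum). -/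
noncomputable def lengthComplexity {R : Type v} {α : Type u} (lang : R → Set (List α))
    (C : Set R) : ℕ∞ :=
  ⨆ (E ∈ C) (E' ∈ C) (_ : (lang E \ lang E').Nonempty),
    ⨅ x ∈ lang E \ lang E', (x.length : ℕ∞)

/-- `N` is a length generalization bound for the representations in `C`: whatever the target in
`C`, a representation in `C` that classifies all strings of length at most `N` like the target
represents the language of the target. -/
def IsLengthGeneralizationBound {R : Type v} {α : Type u} (lang : R → Set (List α))
    (C : Set R) (N : ℕ) : Prop :=
  ∀ target ∈ C, ∀ E ∈ C,
    (∀ x : List α, x.length ≤ N → (x ∈ lang E ↔ x ∈ lang target)) → lang E = lang target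

/-! Rounding makes attention forget large counts. A position sees the earlier ones only through the
number of times each state in `FixedPrecision p s`-vectors occurs, and these counts matter only up
to `M = 2 ^ (p + s)`. If a state with positive rounded logit occurs `M` times, the normalizer is so
large that all weights round to `0`; otherwise the relevant counts are known exactly
(`countAttention_congr`). So at each layer it suffices to keep the first `M` positions of each
state: any subsequence containing them has the same capped counts (`min_visibleCount_comp`), hence
the same activations. The union over the layers, over two transformers, and the first and last
positions gives a short string that both classify like the original (`exists_short_sublist`).
States, not symbols, are counted, so the bound does not depend on the alphabet.

For the lower bound take `s = p` and uniform attention: the weight `1 / n` rounds to `0` exactly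
when `n > 2 ^ p`, so one layer recognizes the strings longer than `2 ^ p`, to be compared with the
empty language. -/

/-! ### Rounding estimates and the number of states. -/

section Rounding

theorem fpRound_eq_zero (p s : ℕ) {x : ℝ} (h0 : 0 ≤ x) (h1 : x * 2 ^ s < 1) :
    (fpRound p s x : ℝ) = 0 := by
  have hf : ⌊x * 2 ^ s⌋ = 0 := by
    rw [Int.floor_eq_zero_iff]
    exact ⟨by positivity, h1⟩
  have h2 : (0 : ℤ) < 2 ^ (p - 1) := by positivity
  have h3 : max (-2 ^ (p - 1)) (min ⌊x * 2 ^ s⌋ (2 ^ (p - 1) - 1)) = 0 := by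
    rw [hf, min_eq_left (by linarith), max_eq_right (by linarith)]
  change ((max (-2 ^ (p - 1)) (min ⌊x * 2 ^ s⌋ (2 ^ (p - 1) - 1)) : ℤ) : ℝ) / 2 ^ s = 0
  rw [h3]
  simp

theorem fpRound_nonneg (p s : ℕ) {x : ℝ} (h0 : 0 ≤ x) : (0 : ℝ) ≤ (fpRound p s x : ℝ) := by
  have hf : 0 ≤ ⌊x * 2 ^ s⌋ := Int.floor_nonneg.mpr (by positivity)
  have h2 : (0 : ℤ) < 2 ^ (p - 1) := by positivity
  have h3 : 0 ≤ max (-2 ^ (p - 1)) (min ⌊x * 2 ^ s⌋ (2 ^ (p - 1) - 1)) :=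
    le_max_of_le_right (le_min hf (by linarith))
  change 0 ≤ ((max (-2 ^ (p - 1)) (min ⌊x * 2 ^ s⌋ (2 ^ (p - 1) - 1)) : ℤ) : ℝ) / 2 ^ s
  have := Int.cast_nonneg (R := ℝ) h3
  positivity

/-- The grid has spacing `2 ^ (-s)`. This gap is what forces the normalizer to grow with the number
of positive logits. -/
theorem FixedPrecision.inv_le_of_pos {p s : ℕ} (y : FixedPrecision p s) (h : 0 < (y : ℝ)) :
    1 / 2 ^ s ≤ (y : ℝ) := by
  obtain ⟨y, m, hm1, hm2, rfl⟩ := y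
  change 0 < (m : ℝ) / 2 ^ s at h
  change 1 / 2 ^ s ≤ (m : ℝ) / 2 ^ s
  have hm : 0 < (m : ℝ) := by
    by_contra hc
    exact absurd h (not_lt.mpr (div_nonpos_of_nonpos_of_nonneg (not_lt.mp hc) (by positivity)))
  have : (1 : ℝ) ≤ m := by exact_mod_cast hm
  gcongr

theorem FixedPrecision.lt_bound {p s : ℕ} (y : FixedPrecision p s) :
    (y : ℝ) < 2 ^ (p - 1) / 2 ^ s := by
  obtain ⟨y, m, hm1, hm2, rfl⟩ := y
  change (m : ℝ) / 2 ^ s < 2 ^ (p - 1) / 2 ^ s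
  have : (m : ℝ) < 2 ^ (p - 1) := by exact_mod_cast hm2
  gcongr

theorem FixedPrecision.exists_injective {p : ℕ} (s : ℕ) (hp : 1 ≤ p) :
    ∃ f : FixedPrecision p s → Fin (2 ^ p), Function.Injective f := by
  have hpow : (2 : ℤ) ^ p = 2 * 2 ^ (p - 1) := by
    rw [← pow_succ', Nat.sub_add_cancel hp]
  choose m hm1 hm2 hm using fun y : FixedPrecision p s => y.2
  refine ⟨fun y => ⟨(m y + 2 ^ (p - 1)).toNat, ?_⟩, fun y z hyz => ?_⟩
  · have h1 := hm1 y
    have h2 := hm2 y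
    zify
    rw [Int.toNat_of_nonneg (by linarith)]
    linarith
  · have h1 := hm1 y
    have h2 := hm1 z
    simp only [Fin.mk.injEq] at hyz
    have : m y = m z := by omega
    exact Subtype.ext (by rw [hm y, hm z, this])

theorem FixedPrecision.finite {p : ℕ} (s : ℕ) (hp : 1 ≤ p) : Finite (FixedPrecision p s) :=
  let ⟨_, hf⟩ := FixedPrecision.exists_injective s hp
  Finite.of_injective _ hf

theorem FixedPrecision.card_vector_le {p : ℕ} (s d : ℕ) (hp : 1 ≤ p)
    [Fintype (Fin d → FixedPrecision p s)] :
    Fintype.card (Fin d → FixedPrecision p s) ≤ 2 ^ (p * d) := by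
  obtain ⟨f, hf⟩ := FixedPrecision.exists_injective s hp
  have := Fintype.card_le_of_injective (fun (x : Fin d → FixedPrecision p s) c => f (x c))
    (fun x y hxy => funext fun c => hf (congrFun hxy c))
  simpa [pow_mul] using this

end Rounding

/-! ### Attention as a function of capped state counts. -/

section Attention

variable {S : Type*} [Fintype S]

/-- The rounded attention weight of a state with rounded logit `a σ`, when every state `τ` is
seen `cnt τ` times. -/
noncomputable def countWeight (p s : ℕ) (cnt : S → ℕ) (a : S → ℝ) (σ : S) : ℝ :=
  if ∑ τ, (cnt τ : ℝ) * a τ = 0 then (fpRound p s (1 / ((∑ τ, cnt τ : ℕ) : ℝ)) : ℝ)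
  else (fpRound p s (a σ / ∑ τ, (cnt τ : ℝ) * a τ) : ℝ)

/-- The weighted sum of values, when every state `τ` is seen `cnt τ` times. -/
noncomputable def countAttention (p s : ℕ) (cnt : S → ℕ) (a v : S → ℝ) : ℝ :=
  ∑ σ, (cnt σ : ℝ) * (countWeight p s cnt a σ * v σ)

/-- `M` copies of a logit that is at least `2 ^ (-s)` push the normalizer to `2 ^ p`, while every
logit is below `2 ^ p / 2 ^ s`; the quotients are below the grid spacing. -/
theorem countWeight_eq_zero_of_large {p s M : ℕ} (hM : 2 ^ (p + s) ≤ M) {cnt : S → ℕ} {a : S → ℝ}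
    (ha : ∀ σ, a σ = 0 ∨ 1 / 2 ^ s ≤ a σ) (hb : ∀ σ, a σ < 2 ^ p / 2 ^ s)
    {τ : S} (hτ : 0 < a τ) (hc : M ≤ cnt τ) (σ : S) : countWeight p s cnt a σ = 0 := by
  have hpos : ∀ σ, 0 ≤ a σ := fun σ => by
    rcases ha σ with h | h
    · exact h.ge
    · exact le_trans (by positivity) h
  have hτ' : 1 / 2 ^ s ≤ a τ := (ha τ).resolve_left hτ.ne'
  have hMc : (2 : ℝ) ^ (p + s) ≤ cnt τ := by exact_mod_cast hM.trans hc
  have hB : (2 : ℝ) ^ p ≤ ∑ τ, (cnt τ : ℝ) * a τ := by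
    calc (2 : ℝ) ^ p = 2 ^ (p + s) * (1 / 2 ^ s) := by field_simp; ring
      _ ≤ cnt τ * a τ := by gcongr
      _ ≤ _ := Finset.single_le_sum (f := fun τ => (cnt τ : ℝ) * a τ)
        (fun σ _ => mul_nonneg (Nat.cast_nonneg _) (hpos σ)) (Finset.mem_univ τ)
  have hB0 : 0 < ∑ τ, (cnt τ : ℝ) * a τ := lt_of_lt_of_le (by positivity) hB
  rw [countWeight, if_neg hB0.ne']
  refine fpRound_eq_zero p s (div_nonneg (hpos σ) hB0.le) ?_
  rw [div_mul_eq_mul_div, div_lt_one hB0]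
  have := hb σ
  rw [lt_div_iff₀ (by positivity)] at this
  exact this.trans_le hB

theorem countAttention_congr {p s M : ℕ} (hp : 1 ≤ p) (hM : 2 ^ (p + s) ≤ M) {cnt cnt' : S → ℕ}
    {a : S → ℝ} (v : S → ℝ) (ha : ∀ σ, a σ = 0 ∨ 1 / 2 ^ s ≤ a σ)
    (hb : ∀ σ, a σ < 2 ^ p / 2 ^ s) (hcnt : ∀ σ, min (cnt σ) M = min (cnt' σ) M) :
    countAttention p s cnt a v = countAttention p s cnt' a v := by
  have hM0 : 0 < M := lt_of_lt_of_le (by positivity) hM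
  have hpos : ∀ σ, 0 ≤ a σ := fun σ => by
    rcases ha σ with h | h
    · exact h.ge
    · exact le_trans (by positivity) h
  have heq : ∀ σ, cnt σ < M → cnt' σ = cnt σ := fun σ h => by have := hcnt σ; omega
  have hge : ∀ σ, M ≤ cnt σ → M ≤ cnt' σ := fun σ h => by have := hcnt σ; omega
  have hvanish : (∀ σ, countWeight p s cnt a σ = 0) → (∀ σ, countWeight p s cnt' a σ = 0) →
      countAttention p s cnt a v = countAttention p s cnt' a v := fun h h' => by
    simp [countAttention, h, h']
  by_cases hlarge : ∃ τ, 0 < a τ ∧ M ≤ cnt τ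
  · obtain ⟨τ, hτ, hc⟩ := hlarge
    exact hvanish (countWeight_eq_zero_of_large hM ha hb hτ hc)
      (countWeight_eq_zero_of_large hM ha hb hτ (hge τ hc))
  push Not at hlarge
  -- From here on, only states with zero logit can have different counts, and they do not contribute
  -- to the normalizer.
  have hsame : ∀ τ, (cnt τ : ℝ) * a τ = cnt' τ * a τ := fun τ => by
    rcases (hpos τ).eq_or_lt with h | h
    · simp [← h]
    · rw [heq τ (hlarge τ h)]
  have hB : ∑ τ, (cnt τ : ℝ) * a τ = ∑ τ, (cnt' τ : ℝ) * a τ :=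
    Finset.sum_congr rfl fun τ _ => hsame τ
  -- With zero normalizer the weights are uniform, so counts of zero-logit states do matter. Either
  -- all counts are below the cap and agree, or more than `2 ^ s` positions are visible and the
  -- uniform weight rounds to `0` on both sides.
  by_cases h0 : ∑ τ, (cnt τ : ℝ) * a τ = 0
  · by_cases hall : ∀ τ, cnt τ < M
    · have : cnt' = cnt := funext fun τ => heq τ (hall τ)
      rw [this]
    · push Not at hall
      obtain ⟨τ, hτ⟩ := hall
      have hsmall : ∀ c : S → ℕ, M ≤ c τ →
          (fpRound p s (1 / ((∑ τ, c τ : ℕ) : ℝ)) : ℝ) = 0 := fun c hc => by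
        have h1 : 2 ^ s < ∑ τ, c τ := by
          calc 2 ^ s < 2 ^ (p + s) := Nat.pow_lt_pow_right (by norm_num) (by omega)
            _ ≤ c τ := hM.trans hc
            _ ≤ _ := Finset.single_le_sum (f := c) (fun _ _ => Nat.zero_le _) (Finset.mem_univ τ)
        have h2 : (2 : ℝ) ^ s < ((∑ τ, c τ : ℕ) : ℝ) := by exact_mod_cast h1
        have h3 : (0 : ℝ) < ((∑ τ, c τ : ℕ) : ℝ) := lt_trans (by positivity) h2
        refine fpRound_eq_zero p s (by positivity) ?_
        rwa [div_mul_eq_mul_div, one_mul, div_lt_one h3]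
      refine hvanish (fun σ => ?_) (fun σ => ?_)
      · rw [countWeight, if_pos h0, hsmall cnt hτ]
      · rw [countWeight, if_pos (hB ▸ h0), hsmall cnt' (hge τ hτ)]
  · refine Finset.sum_congr rfl fun σ _ => ?_
    have hw : countWeight p s cnt a σ = countWeight p s cnt' a σ := by
      rw [countWeight, countWeight, if_neg h0, if_neg (hB ▸ h0), hB]
    rcases (hpos σ).eq_or_lt with h | h
    · have hz : countWeight p s cnt a σ = 0 := by
        rw [countWeight, if_neg h0, ← h, zero_div]
        exact fpRound_eq_zero p s le_rfl (by simp)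
      rw [← hw, hz]
      simp
    · rw [hw, heq σ (hlarge σ h)]

end Attention

/-! ### From positions to state counts. -/

namespace FPLayer

open Classical in
/-- The number of visible positions with state `σ`. -/
noncomputable def visibleCount {S : Type*} {n : ℕ} (h : Fin n → S) (i : Fin n) (σ : S) : ℕ :=
  (Finset.univ.filter fun j => j ≤ i ∧ h j = σ).card

theorem sum_visible_eq {S : Type*} [Fintype S] {n : ℕ} (h : Fin n → S) (i : Fin n) (g : S → ℝ) :
    ∑ j ∈ Finset.Iic i, g (h j) = ∑ σ, (visibleCount h i σ : ℝ) * g σ := by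
  classical
  rw [← Finset.sum_fiberwise (Finset.Iic i) h]
  refine Finset.sum_congr rfl fun σ _ => ?_
  rw [Finset.sum_congr rfl (g := fun _ => g σ) (by simp +contextual), Finset.sum_const,
    nsmul_eq_mul, visibleCount]
  congr 3
  ext j
  simp

theorem sum_visibleCount {S : Type*} [Fintype S] {n : ℕ} (h : Fin n → S) (i : Fin n) :
    ∑ σ, visibleCount h i σ = (i : ℕ) + 1 := by
  have := sum_visible_eq h i fun _ => 1
  simp only [Finset.sum_const, Fin.card_Iic, nsmul_eq_mul, mul_one] at this
  exact_mod_cast this.symm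

variable {p s d n : ℕ}

/-- The rounded exponentiated attention logit as a function of the two states. -/
noncomputable def stateLogit (l : FPLayer p s d) (σ τ : Fin d → FixedPrecision p s) : ℝ :=
  (fpRound p s (Real.exp (∑ c, (l.query σ c : ℝ) * (l.key τ c : ℝ))) : ℝ)

theorem stateLogit_zero_or (l : FPLayer p s d) (σ τ : Fin d → FixedPrecision p s) :
    l.stateLogit σ τ = 0 ∨ 1 / 2 ^ s ≤ l.stateLogit σ τ := by
  rcases (fpRound_nonneg p s (Real.exp_pos _).le : 0 ≤ l.stateLogit σ τ).eq_or_lt with h | h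
  · exact Or.inl h.symm
  · exact Or.inr (FixedPrecision.inv_le_of_pos _ h)

theorem stateLogit_lt (l : FPLayer p s d) (σ τ : Fin d → FixedPrecision p s) :
    l.stateLogit σ τ < 2 ^ p / 2 ^ s := by
  refine (FixedPrecision.lt_bound _).trans_le ?_
  gcongr
  · norm_num
  · omega

theorem attention_eq [Fintype (Fin d → FixedPrecision p s)] (l : FPLayer p s d)
    (h : Fin n → Fin d → FixedPrecision p s) (i : Fin n) (c : Fin d) :
    l.attention h i c = fpRound p s
      (countAttention p s (visibleCount h i) (l.stateLogit (h i)) fun τ => (l.value τ c : ℝ)) := by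
  have hB : l.normalizer h i = ∑ τ, (visibleCount h i τ : ℝ) * l.stateLogit (h i) τ :=
    sum_visible_eq h i (l.stateLogit (h i))
  have hw : ∀ j, l.weight h i j =
      countWeight p s (visibleCount h i) (l.stateLogit (h i)) (h j) := fun j => by
    rw [weight, countWeight, hB, sum_visibleCount]
    push_cast
    rfl
  rw [attention, countAttention, ← sum_visible_eq h i fun τ =>
    countWeight p s (visibleCount h i) (l.stateLogit (h i)) τ * (l.value τ c : ℝ)]
  simp only [hw]

theorem apply_congr {m M : ℕ} (hp : 1 ≤ p) (hM : 2 ^ (p + s) ≤ M) (l : FPLayer p s d)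
    {h : Fin n → Fin d → FixedPrecision p s} {h' : Fin m → Fin d → FixedPrecision p s}
    {i : Fin n} {i' : Fin m} (hi : h i = h' i')
    (hcnt : ∀ σ, min (visibleCount h i σ) M = min (visibleCount h' i' σ) M) :
    l.apply h i = l.apply h' i' := by
  have := FixedPrecision.finite s hp
  have := Fintype.ofFinite (Fin d → FixedPrecision p s)
  have hatt : ∀ c, l.attention h i c = l.attention h' i' c := fun c => by
    rw [attention_eq, attention_eq, hi, countAttention_congr hp hM _ (l.stateLogit_zero_or _)
      (l.stateLogit_lt _) hcnt]
  simp only [apply, hatt, hi]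

/-! ### Positions that preserve the capped counts. -/

open Classical in
/-- The positions that are among the first `M` ones with the same state. -/
noncomputable def earlyPositions {S : Type*} (M : ℕ) (h : Fin n → S) : Finset (Fin n) :=
  Finset.univ.filter fun j => (Finset.univ.filter fun k => k < j ∧ h k = h j).card < M

/-- Within one state, an early position is determined by its number of predecessors in that state,
which is less than `M`. -/
theorem card_earlyPositions_le {S : Type*} [Fintype S] (M : ℕ) (h : Fin n → S) :
    (earlyPositions M h).card ≤ M * Fintype.card S := by
  classical
  refine Finset.card_le_mul_card_image_of_maps_to (f := h) (t := Finset.univ) (by simp) M ?_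
  intro σ _
  refine le_of_le_of_eq ?_ (Finset.card_range M)
  refine Finset.card_le_card_of_injOn
    (fun j => (Finset.univ.filter fun k => k < j ∧ h k = h j).card) ?_ ?_
  · intro j hj
    simp only [earlyPositions, Finset.coe_filter, Finset.mem_filter, Finset.mem_univ, true_and,
      Set.mem_ofPred_eq] at hj
    simp only [Finset.coe_range, Set.mem_Iio]
    exact hj.1
  · have key : ∀ i j : Fin n, h i = σ → h j = σ → i < j →
        (Finset.univ.filter fun k => k < i ∧ h k = h i).card <
        (Finset.univ.filter fun k => k < j ∧ h k = h j).card := by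
      intro i j hi hj hij
      refine Finset.card_lt_card ((Finset.ssubset_iff_of_subset fun k hk => ?_).mpr ⟨i, ?_, ?_⟩)
      · simp only [Finset.mem_filter, Finset.mem_univ, true_and, hi, hj] at hk ⊢
        exact ⟨hk.1.trans hij, hk.2⟩
      · simp [hij, hi, hj]
      · simp
    intro i hi j hj hij
    simp only [Finset.coe_filter, Set.mem_ofPred_eq] at hi hj
    rcases lt_trichotomy i j with hlt | heq | hlt
    · exact absurd hij (key i j hi.2 hj.2 hlt).ne
    · exact heq
    · exact absurd hij (key j i hj.2 hi.2 hlt).ne'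

theorem min_visibleCount_comp {S : Type*} {m M : ℕ} (h : Fin n → S) {e : Fin m → Fin n}
    (he : StrictMono e) (hM : (earlyPositions M h : Set (Fin n)) ⊆ Set.range e)
    (i : Fin m) (σ : S) :
    min (visibleCount (h ∘ e) i σ) M = min (visibleCount h (e i) σ) M := by
  classical
  have himage : ∀ A : Finset (Fin n), (∀ j ∈ A, j ≤ e i ∧ h j = σ ∧ j ∈ Set.range e) →
      A.card ≤ visibleCount (h ∘ e) i σ := by
    intro A hA
    rw [visibleCount, ← Finset.card_image_of_injective _ he.injective]
    refine Finset.card_le_card fun j hj => ?_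
    obtain ⟨h1, h2, k, rfl⟩ := hA j hj
    exact Finset.mem_image_of_mem _ (by simpa using ⟨he.le_iff_le.mp h1, h2⟩)
  have hle : visibleCount (h ∘ e) i σ ≤ visibleCount h (e i) σ := by
    rw [visibleCount, visibleCount, ← Finset.card_image_of_injective _ he.injective]
    refine Finset.card_le_card fun j hj => ?_
    obtain ⟨k, hk, rfl⟩ := Finset.mem_image.mp hj
    simp only [Finset.mem_filter, Finset.mem_univ, true_and, Function.comp_apply] at hk ⊢
    exact ⟨he.monotone hk.1, hk.2⟩
  rcases le_or_gt M (visibleCount (h ∘ e) i σ) with hc | hc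
  · rw [min_eq_right hc, min_eq_right (hc.trans hle)]
  -- If the subsequence sees fewer than `M` positions of state `σ`, none was dropped: by strong
  -- induction all predecessors of `j` in state `σ` are kept, so there are fewer than `M` of them,
  -- so `j` is early and kept too.
  have hall : ∀ j : Fin n, j ≤ e i → h j = σ → j ∈ Set.range e := by
    intro j
    induction j using WellFoundedLT.induction with
    | ind j ih =>
      intro hj hσ
      apply hM
      simp only [earlyPositions, Finset.coe_filter, Finset.mem_univ, true_and, Set.mem_ofPred_eq]
      refine lt_of_le_of_lt (himage _ fun k hk => ?_) hc
      simp only [Finset.mem_filter, Finset.mem_univ, true_and] at hk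
      exact ⟨hk.1.le.trans hj, hk.2.trans hσ, ih k hk.1 (hk.1.le.trans hj) (hk.2.trans hσ)⟩
  have hge : visibleCount h (e i) σ ≤ visibleCount (h ∘ e) i σ := by
    refine himage _ fun j hj => ?_
    simp only [Finset.mem_filter, Finset.mem_univ, true_and] at hj
    exact ⟨hj.1, hj.2, hall j hj.1 hj.2⟩
  rw [le_antisymm hle hge]

/-- A small set of positions such that passing to any subsequence that contains them does not
change the activations. -/
theorem exists_core_positions (hp : 1 ≤ p) (hs : s ≤ p) (ls : List (FPLayer p s d))
    (h : Fin n → Fin d → FixedPrecision p s) :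
    ∃ P : Finset (Fin n), P.card ≤ ls.length * 2 ^ (2 * p + p * d) ∧
      ∀ (m : ℕ) (e : Fin m → Fin n), StrictMono e → (P : Set (Fin n)) ⊆ Set.range e →
        ls.foldl (fun h l => l.apply h) (h ∘ e) = ls.foldl (fun h l => l.apply h) h ∘ e := by
  classical
  have := FixedPrecision.finite s hp
  have := Fintype.ofFinite (Fin d → FixedPrecision p s)
  induction ls generalizing h with
  | nil => exact ⟨∅, by simp, fun _ _ _ _ => rfl⟩
  | cons l ls ih =>
    obtain ⟨P, hP, hPe⟩ := ih (l.apply h)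
    refine ⟨earlyPositions (2 ^ (2 * p)) h ∪ P, ?_, fun m e he hsub => ?_⟩
    · refine (Finset.card_union_le _ _).trans ?_
      have h1 := card_earlyPositions_le (2 ^ (2 * p)) h
      have h2 := Nat.mul_le_mul_left (2 ^ (2 * p)) (FixedPrecision.card_vector_le s d hp)
      rw [← pow_add] at h2
      rw [List.length_cons, add_mul, one_mul]
      linarith
    · rw [Finset.coe_union, Set.union_subset_iff] at hsub
      -- The cap `2 ^ (2 * p)` dominates `2 ^ (p + s)` for every `s ≤ p`, so the bound is free of
      -- `s`.
      have hl : l.apply (h ∘ e) = l.apply h ∘ e := funext fun i =>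
        apply_congr hp (M := 2 ^ (2 * p)) (Nat.pow_le_pow_right (by norm_num) (by omega)) l rfl
          (min_visibleCount_comp h he hsub.1 i)
      rw [List.foldl_cons, List.foldl_cons, hl]
      exact hPe m e he hsub.2

end FPLayer

theorem List.exists_positions {α : Type*} (x : List α) (P : Finset (Fin x.length)) :
    ∃ (y : List α) (e : Fin y.length → Fin x.length), y.length = P.card ∧ StrictMono e ∧
      Set.range e = (P : Set (Fin x.length)) ∧ ∀ k, y.get k = x.get (e k) := by
  refine ⟨List.ofFn fun k => x.get (P.orderEmbOfFin rfl k),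
    fun k => P.orderEmbOfFin rfl (k.cast (by simp)), by simp, fun i j hij => ?_, ?_, ?_⟩
  · exact (P.orderEmbOfFin rfl).strictMono hij
  · rw [← P.range_orderEmbOfFin rfl]
    ext j
    constructor
    · rintro ⟨k, rfl⟩
      exact ⟨_, rfl⟩
    · rintro ⟨k, rfl⟩
      exact ⟨k.cast (by simp), rfl⟩
  · intro k
    simp
    rfl

/-! ### Short separating strings. -/

namespace FPTransformer

theorem hidden_eq_of_positions {α : Type u} (T : FPTransformer α) (x : List α) :
    ∃ P : Finset (Fin x.length),
      P.card ≤ T.depth * 2 ^ (2 * T.precision + T.precision * T.dim) ∧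
      ∀ (y : List α) (e : Fin y.length → Fin x.length), StrictMono e →
        (P : Set (Fin x.length)) ⊆ Set.range e → (∀ k, y.get k = x.get (e k)) →
        T.hidden y = T.hidden x ∘ e := by
  obtain ⟨P, hP, hPe⟩ := FPLayer.exists_core_positions T.precision_pos T.fracBits_le T.layers
    (fun i => T.embed (x.get i))
  refine ⟨P, hP, fun y e he hsub hget => ?_⟩
  rw [hidden, hidden, ← hPe _ e he hsub]
  congr 1
  funext k
  rw [hget, Function.comp_apply]

/-- The bound on the length of strings that separate two languages. -/
def lengthBound (p d L : ℕ) : ℕ := 2 ^ (p * d + 2 * p + L + 1)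

/-- A string can be shortened to a subsequence of bounded length, with the same first symbol,
that two given transformers classify like the original. -/
theorem exists_short_sublist {α : Type u} {p d L : ℕ} {T T' : FPTransformer α}
    (hT : T ∈ atMost α p d L) (hT' : T' ∈ atMost α p d L) {x : List α} (hx : x ≠ []) :
    ∃ y : List α, y.Sublist x ∧ y.length ≤ lengthBound p d L ∧ y.head? = x.head? ∧
      (y ∈ T.language ↔ x ∈ T.language) ∧ (y ∈ T'.language ↔ x ∈ T'.language) := by
  classical
  have hbound : ∀ T ∈ atMost α p d L,
      T.depth * 2 ^ (2 * T.precision + T.precision * T.dim) ≤ L * 2 ^ (2 * p + p * d) := by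
    rintro T ⟨h1, h2, h3⟩
    gcongr
    norm_num
  obtain ⟨P, hP, hPe⟩ := T.hidden_eq_of_positions x
  obtain ⟨P', hP', hPe'⟩ := T'.hidden_eq_of_positions x
  have hx0 : 0 < x.length := List.length_pos_of_ne_nil hx
  let first : Fin x.length := ⟨0, hx0⟩
  let last : Fin x.length := ⟨x.length - 1, Nat.sub_lt hx0 Nat.one_pos⟩
  obtain ⟨y, e, hlen, he, hrange, hget⟩ :=
    -- The output is read at the last position; the first one is kept so that a beginning-of-string
    -- symbol survives.
    List.exists_positions x (insert first (insert last (P ∪ P')))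
  obtain ⟨k₀, hk₀⟩ : first ∈ Set.range e := by rw [hrange]; simp
  obtain ⟨k₁, hk₁⟩ : last ∈ Set.range e := by rw [hrange]; simp
  have hy0 : 0 < y.length := k₀.pos
  have hy : y ≠ [] := List.ne_nil_of_length_pos hy0
  have hfirst : e ⟨0, hy0⟩ = first := by
    apply le_antisymm
    · rw [← hk₀]
      exact he.monotone (Nat.zero_le _)
    · exact Nat.zero_le _
  have hlast : e ⟨y.length - 1, Nat.sub_lt hy0 Nat.one_pos⟩ = last := by
    apply le_antisymm
    · exact Nat.le_sub_one_of_lt (Fin.isLt _)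
    · rw [← hk₁]
      exact he.monotone (Nat.le_sub_one_of_lt k₁.isLt)
  have hlang : ∀ T : FPTransformer α, T.hidden y = T.hidden x ∘ e →
      (y ∈ T.language ↔ x ∈ T.language) := fun T h => by
    have : T.output y hy = T.output x hx := by
      rw [output, output, h, Function.comp_apply, hlast]
    exact ⟨fun ⟨_, h⟩ => ⟨hx, this ▸ h⟩, fun ⟨_, h⟩ => ⟨hy, this.symm ▸ h⟩⟩
  refine ⟨y, ?_, ?_, ?_, hlang T (hPe y e he ?_ hget), hlang T' (hPe' y e he ?_ hget)⟩
  · rw [List.sublist_iff_exists_fin_orderEmbedding_get_eq]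
    exact ⟨OrderEmbedding.ofStrictMono e he, hget⟩
  · have h1 := Finset.card_insert_le first (insert last (P ∪ P'))
    have h2 := Finset.card_insert_le last (P ∪ P')
    have h3 := Finset.card_union_le P P'
    have h4 := hbound T hT
    have h5 := hbound T' hT'
    -- With `K = 2 ^ (2 * p + p * d)`, the length is at most `2 + 2 * L * K ≤ 2 * (L + 1) * K`; the
    -- extra `K` absorbs the two end positions.
    have h6 : (L + 1) * 2 ^ (2 * p + p * d) ≤ 2 ^ L * 2 ^ (2 * p + p * d) :=
      Nat.mul_le_mul_right _ Nat.lt_two_pow_self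
    have h7 : lengthBound p d L = 2 * (2 ^ L * 2 ^ (2 * p + p * d)) := by
      rw [lengthBound]
      ring
    have h8 : 1 ≤ 2 ^ (2 * p + p * d) := Nat.one_le_two_pow
    rw [h7, hlen]
    linarith
  · have h := hget ⟨0, hy0⟩
    rw [hfirst] at h
    rw [List.head?_eq_getElem?, List.head?_eq_getElem?, List.getElem?_eq_getElem hy0,
      List.getElem?_eq_getElem hx0]
    exact congrArg some h
  · rw [hrange]
    intro j hj
    simp [Finset.mem_coe.mp hj]
  · rw [hrange]
    intro j hj
    simp [Finset.mem_coe.mp hj]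

theorem exists_short_mem_language_diff {α : Type u} {p d L : ℕ} {T T' : FPTransformer α}
    (hT : T ∈ atMost α p d L) (hT' : T' ∈ atMost α p d L) {x : List α}
    (hx : x ∈ T.language \ T'.language) :
    ∃ y ∈ T.language \ T'.language, y.length ≤ lengthBound p d L := by
  obtain ⟨y, -, hlen, -, h, h'⟩ := exists_short_sublist hT hT' hx.1.1
  exact ⟨y, ⟨h.mpr hx.1, fun hc => hx.2 (h'.mp hc)⟩, hlen⟩

/-- The shortened string still starts with `none`, and its tail, a sublist of `x.map some`, is again
the image of a string over `α`. -/
theorem exists_short_mem_bosLanguage_diff {α : Type u} {p d L : ℕ}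
    {T T' : FPTransformer (Option α)}
    (hT : T ∈ atMost (Option α) p d L) (hT' : T' ∈ atMost (Option α) p d L) {x : List α}
    (hx : x ∈ T.bosLanguage \ T'.bosLanguage) :
    ∃ y ∈ T.bosLanguage \ T'.bosLanguage, y.length ≤ lengthBound p d L := by
  obtain ⟨y, hsub, hlen, hhead, h, h'⟩ :=
    exists_short_sublist hT hT' (List.cons_ne_nil none (x.map some))
  obtain ⟨z, rfl⟩ : ∃ z, y = none :: z := List.head?_eq_some_iff.mp (by simpa using hhead)
  obtain ⟨w, -, rfl⟩ := List.sublist_map_iff.mp (List.cons_sublist_cons.mp hsub)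
  refine ⟨w, ⟨h.mpr hx.1, fun hc => hx.2 (h'.mp hc)⟩, ?_⟩
  rw [List.length_cons, List.length_map] at hlen
  omega

theorem computable_lengthBound :
    Computable fun x : ℕ × ℕ × ℕ => lengthBound x.1 x.2.1 x.2.2 := by
  have hpow : Primrec₂ fun m n : ℕ => m ^ n := Primrec₂.unpaired'.mp Nat.Primrec.pow
  have hp : Primrec fun x : ℕ × ℕ × ℕ => x.1 := Primrec.fst
  have hd : Primrec fun x : ℕ × ℕ × ℕ => x.2.1 := Primrec.fst.comp Primrec.snd
  have hL : Primrec fun x : ℕ × ℕ × ℕ => x.2.2 := Primrec.snd.comp Primrec.snd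
  have h1 : Primrec fun x : ℕ × ℕ × ℕ => x.1 * x.2.1 := Primrec.nat_mul.comp hp hd
  have h2 : Primrec fun x : ℕ × ℕ × ℕ => 2 * x.1 := Primrec.nat_mul.comp (Primrec.const 2) hp
  have h3 : Primrec fun x : ℕ × ℕ × ℕ => x.1 * x.2.1 + 2 * x.1 + x.2.2 + 1 :=
    Primrec.nat_add.comp (Primrec.nat_add.comp (Primrec.nat_add.comp h1 h2) hL) (Primrec.const 1)
  exact (hpow.comp (Primrec.const 2) h3).to_comp

end FPTransformer

/-! ### Length complexity and length generalization from short witnesses. -/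

theorem lengthComplexity_le_of_short {R : Type v} {α : Type u} {lang : R → Set (List α)}
    {C : Set R} {N : ℕ}
    (h : ∀ E ∈ C, ∀ E' ∈ C, ∀ x ∈ lang E \ lang E', ∃ y ∈ lang E \ lang E', y.length ≤ N) :
    lengthComplexity lang C ≤ N := by
  refine iSup₂_le fun E hE => iSup₂_le fun E' hE' => iSup_le fun ⟨x, hx⟩ => ?_
  obtain ⟨y, hy, hlen⟩ := h E hE E' hE' x hx
  exact iInf₂_le_of_le y hy (by exact_mod_cast hlen)

theorem isLengthGeneralizationBound_of_short {R : Type v} {α : Type u} {lang : R → Set (List α)}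
    {C : Set R} {N : ℕ}
    (h : ∀ E ∈ C, ∀ E' ∈ C, ∀ x ∈ lang E \ lang E', ∃ y ∈ lang E \ lang E', y.length ≤ N) :
    IsLengthGeneralizationBound lang C N := by
  intro T hT E hE hagree
  refine Set.Subset.antisymm (fun x hx => ?_) (fun x hx => ?_)
  · by_contra hc
    obtain ⟨y, hy, hlen⟩ := h E hE T hT x ⟨hx, hc⟩
    exact hy.2 ((hagree y hlen).mp hy.1)
  · by_contra hc
    obtain ⟨y, hy, hlen⟩ := h T hT E hE x ⟨hx, hc⟩
    exact hy.2 ((hagree y hlen).mpr hy.1)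

theorem le_lengthComplexity {R : Type v} {α : Type u} {lang : R → Set (List α)}
    {C : Set R} {N : ℕ∞} {E E' : R} (hE : E ∈ C) (hE' : E' ∈ C)
    (hne : (lang E \ lang E').Nonempty) (h : ∀ x ∈ lang E \ lang E', N ≤ (x.length : ℕ∞)) :
    N ≤ lengthComplexity lang C :=
  le_iSup₂_of_le E hE (le_iSup₂_of_le E' hE' (le_iSup_of_le hne (le_iInf₂ h)))

/-! ### The lower bound: detecting lengths above `2 ^ p`. -/

section LowerBound

/-- The smallest fixed-precision number with `p` fractional bits. -/
noncomputable def FixedPrecision.lowest (p : ℕ) : FixedPrecision p p :=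
  ⟨((-2 ^ (p - 1) : ℤ) : ℝ) / 2 ^ p, -2 ^ (p - 1), le_rfl, by
    have h : (0 : ℤ) < 2 ^ (p - 1) := by positivity
    linarith, rfl⟩

/-- Zero as a fixed-precision number. -/
noncomputable def FixedPrecision.zero (p s : ℕ) : FixedPrecision p s :=
  ⟨0, 0, by simp, by positivity, by simp⟩

/-- Rounding down never sends a negative number to `0`. This is why the construction uses negative
values: their sign survives all later roundings without size estimates. -/
theorem fpRound_neg_iff {p : ℕ} (s : ℕ) {x : ℝ} : (fpRound p s x : ℝ) < 0 ↔ x < 0 := by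
  refine ⟨fun h => ?_, fun h => ?_⟩
  · by_contra hc
    exact absurd (fpRound_nonneg p s (not_lt.mp hc)) (not_le.mpr h)
  · have h2 : (0 : ℤ) < 2 ^ (p - 1) := by positivity
    have hf : ⌊x * 2 ^ s⌋ < 0 := by
      rw [Int.floor_lt]
      push_cast
      exact mul_neg_of_neg_of_pos h (by positivity)
    have h3 : max (-2 ^ (p - 1)) (min ⌊x * 2 ^ s⌋ (2 ^ (p - 1) - 1)) < 0 :=
      max_lt (by linarith) (min_lt_of_left_lt hf)
    exact div_neg_of_neg_of_pos (Int.cast_lt_zero.mpr h3) (by positivity)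

/-- For `p = 1` the largest grid number is `0`; positive ones exist only from `p = 2` on. -/
theorem fpRound_pos {p : ℕ} (s : ℕ) (hp : 2 ≤ p) {x : ℝ} (hx : 1 ≤ x * 2 ^ s) :
    0 < (fpRound p s x : ℝ) := by
  have h2 : (2 : ℤ) ≤ 2 ^ (p - 1) := le_self_pow₀ (by norm_num) (by omega)
  have hf : 1 ≤ ⌊x * 2 ^ s⌋ := Int.le_floor.mpr (by exact_mod_cast hx)
  have h3 : 0 < max (-2 ^ (p - 1)) (min ⌊x * 2 ^ s⌋ (2 ^ (p - 1) - 1)) :=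
    lt_max_of_lt_right (lt_min hf (by linarith))
  exact div_pos (Int.cast_pos.mpr h3) (by positivity)

theorem fpRound_inv_eq_zero_iff {p : ℕ} (hp : 2 ≤ p) {n : ℕ} (hn : 0 < n) :
    (fpRound p p (1 / (n : ℝ)) : ℝ) = 0 ↔ 2 ^ p < n := by
  have hn' : (0 : ℝ) < n := by exact_mod_cast hn
  refine ⟨fun h => ?_, fun h => ?_⟩
  · by_contra hc
    have hc' : (n : ℝ) ≤ 2 ^ p := by exact_mod_cast not_lt.mp hc
    refine (fpRound_pos p hp ?_).ne' h
    rwa [div_mul_eq_mul_div, one_mul, one_le_div hn']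
  · refine fpRound_eq_zero p p (by positivity) ?_
    rw [div_mul_eq_mul_div, one_mul, div_lt_one hn']
    exact_mod_cast h

namespace FPLayer

/-- A layer that outputs zero everywhere. -/
noncomputable def zeroLayer (p s d : ℕ) : FPLayer p s d :=
  ⟨id, id, id, fun _ _ => FixedPrecision.zero p s⟩

/-- A layer that attends uniformly to the lowest possible value. -/
noncomputable def uniformLayer (p d : ℕ) : FPLayer p p d :=
  ⟨fun _ _ => FixedPrecision.zero p p, id, fun _ _ => FixedPrecision.lowest p, id⟩

theorem foldl_zeroLayer {p s d n : ℕ} (k : ℕ) :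
    (List.replicate k (zeroLayer p s d)).foldl (fun h l => l.apply h)
      (fun (_ : Fin n) _ => FixedPrecision.zero p s) = fun _ _ => FixedPrecision.zero p s := by
  induction k with
  | zero => rfl
  | succ k ih => exact ih

/-- With `s = p` the number `1` lies above the range, so the logits saturate. Being all equal, they
cancel in the quotient, and the default for a vanishing normalizer gives the same weight. -/
theorem uniformLayer_weight {p d n : ℕ} (h : Fin n → Fin d → FixedPrecision p p)
    (i j : Fin n) :
    (uniformLayer p d).weight h i j = (fpRound p p (1 / (((i : ℕ) + 1 : ℕ) : ℝ)) : ℝ) := by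
  have hl : ∀ j, (uniformLayer p d).expLogit h i j = (fpRound p p 1 : ℝ) := fun j => by
    simp [expLogit, uniformLayer, FixedPrecision.zero]
  have hB : (uniformLayer p d).normalizer h i = ((i : ℕ) + 1) * (fpRound p p 1 : ℝ) := by
    simp [normalizer, hl]
  rw [weight, hB, hl]
  split_ifs with h0
  · push_cast
    rfl
  · have h1 : (fpRound p p 1 : ℝ) ≠ 0 := right_ne_zero_of_mul h0
    have h2 : ((i : ℕ) + 1 : ℝ) ≠ 0 := left_ne_zero_of_mul h0
    push_cast
    congr 2
    field_simp

theorem uniformLayer_apply_neg_iff {p d n : ℕ} (hp : 2 ≤ p) (i : Fin n) (c : Fin d) :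
    ((uniformLayer p d).apply (fun (_ : Fin n) _ => FixedPrecision.zero p p) i c : ℝ) < 0 ↔
      (i : ℕ) + 1 ≤ 2 ^ p := by
  set h : Fin n → Fin d → FixedPrecision p p := fun _ _ => FixedPrecision.zero p p
  have hlow : (FixedPrecision.lowest p : ℝ) < 0 := by
    change ((-2 ^ (p - 1) : ℤ) : ℝ) / 2 ^ p < 0
    push_cast
    exact div_neg_of_neg_of_pos (by simp) (by positivity)
  have hz : ((h i c : FixedPrecision p p) : ℝ) = 0 := rfl
  change (fpRound p p (((uniformLayer p d).attention h i c : ℝ) + (h i c : ℝ)) : ℝ) < 0 ↔ _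
  rw [fpRound_neg_iff, hz, add_zero, attention, fpRound_neg_iff]
  have hsum : ∑ j ∈ Finset.Iic i,
        (uniformLayer p d).weight h i j * ((uniformLayer p d).value (h j) c : ℝ) =
      ((i : ℕ) + 1) * ((fpRound p p (1 / (((i : ℕ) + 1 : ℕ) : ℝ)) : ℝ) *
        (FixedPrecision.lowest p : ℝ)) := by
    simp only [uniformLayer_weight]
    simp [uniformLayer]
  -- The sum is a positive multiple of the common weight times a negative number, hence negative
  -- unless that weight rounds to `0`.
  rw [hsum, ← not_lt, ← fpRound_inv_eq_zero_iff hp (Nat.succ_pos i)]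
  have hnn : (0 : ℝ) ≤ (fpRound p p (1 / (((i : ℕ) + 1 : ℕ) : ℝ)) : ℝ) :=
    fpRound_nonneg p p (by positivity)
  refine ⟨fun hneg h0 => ?_, fun h0 => ?_⟩
  · rw [h0] at hneg
    simp at hneg
  · exact mul_neg_of_pos_of_neg (by positivity)
      (mul_neg_of_pos_of_neg (lt_of_le_of_ne hnn (Ne.symm h0)) hlow)

end FPLayer

namespace FPTransformer

/-- Zero layers followed by one uniform layer, with a given unembedding. -/
noncomputable def uniformTransformer (α : Type u) (p d L : ℕ) (hp : 2 ≤ p)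
    (g : (Fin d → FixedPrecision p p) → FixedPrecision p p) : FPTransformer α where
  precision := p
  fracBits := p
  dim := d
  precision_pos := by omega
  fracBits_le := le_rfl
  embed _ _ := FixedPrecision.zero p p
  layers := List.replicate (L - 1) (FPLayer.zeroLayer p p d) ++ [FPLayer.uniformLayer p d]
  unembed := g

theorem uniformTransformer_mem_exactly {α : Type u} {p d L : ℕ} (hp : 2 ≤ p) (hL : 1 ≤ L)
    (g : (Fin d → FixedPrecision p p) → FixedPrecision p p) :
    uniformTransformer α p d L hp g ∈ exactly α p d L := by
  refine ⟨rfl, rfl, ?_⟩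
  simp only [depth, uniformTransformer, List.length_append, List.length_replicate,
    List.length_singleton]
  omega

theorem hidden_uniformTransformer {α : Type u} {p d L : ℕ} (hp : 2 ≤ p)
    (g : (Fin d → FixedPrecision p p) → FixedPrecision p p) (x : List α) :
    (uniformTransformer α p d L hp g).hidden x =
      (FPLayer.uniformLayer p d).apply fun _ _ => FixedPrecision.zero p p := by
  refine List.foldl_append.trans ?_
  exact congrArg (FPLayer.uniformLayer p d).apply (FPLayer.foldl_zeroLayer (L - 1))

theorem language_uniformTransformer_zero {α : Type u} {p d L : ℕ} (hp : 2 ≤ p) :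
    (uniformTransformer α p d L hp fun _ => FixedPrecision.zero p p).language = ∅ := by
  rw [Set.eq_empty_iff_forall_notMem]
  rintro x ⟨_, h⟩
  exact lt_irrefl (0 : ℝ) h

open Classical in
theorem mem_language_uniformTransformer {α : Type u} {p d L : ℕ} (hp : 2 ≤ p) (c : Fin d)
    (x : List α) :
    x ∈ (uniformTransformer α p d L hp fun h =>
      if (h c : ℝ) < 0 then FixedPrecision.zero p p else fpRound p p 1).language ↔
      2 ^ p < x.length := by
  have hone : 0 < (fpRound p p 1 : ℝ) := fpRound_pos p hp (by
    rw [one_mul]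
    exact one_le_pow₀ (by norm_num))
  have key : ∀ hx : x ≠ [], 0 < ((uniformTransformer α p d L hp fun h =>
      if (h c : ℝ) < 0 then FixedPrecision.zero p p else fpRound p p 1).output x hx : ℝ) ↔
      2 ^ p < x.length := fun hx => by
    have hx0 := List.length_pos_of_ne_nil hx
    rw [output, hidden_uniformTransformer]
    have hneg := FPLayer.uniformLayer_apply_neg_iff (d := d) hp
      (⟨x.length - 1, Nat.sub_lt hx0 Nat.one_pos⟩ : Fin x.length) c
    simp only [Nat.sub_add_cancel hx0] at hneg
    simp only [uniformTransformer]
    split_ifs with h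
    · simpa [FixedPrecision.zero] using hneg.mp h
    · simpa [hone] using fun h' => h (hneg.mpr h')
  refine ⟨fun ⟨hx, h⟩ => (key hx).mp h, fun h => ?_⟩
  have hx : x ≠ [] := List.ne_nil_of_length_pos (Nat.zero_lt_of_lt h)
  exact ⟨hx, (key hx).mpr h⟩

theorem pow_le_lengthComplexity_language (α : Type u) [Nonempty α] {p d L : ℕ} (hp : 2 ≤ p)
    (hd : 1 ≤ d) (hL : 1 ≤ L) :
    (2 : ℕ∞) ^ p ≤ lengthComplexity language (exactly α p d L) := by
  classical
  obtain ⟨a⟩ := ‹Nonempty α›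
  refine le_lengthComplexity
    (uniformTransformer_mem_exactly hp hL fun h =>
      if (h ⟨0, hd⟩ : ℝ) < 0 then FixedPrecision.zero p p else fpRound p p 1)
    (uniformTransformer_mem_exactly hp hL fun _ => FixedPrecision.zero p p)
    ⟨List.replicate (2 ^ p + 1) a, ?_, ?_⟩ ?_
  · rw [mem_language_uniformTransformer]
    simp
  · simp [language_uniformTransformer_zero]
  · rintro x ⟨hx, -⟩
    rw [mem_language_uniformTransformer] at hx
    exact_mod_cast hx.le

theorem pow_le_lengthComplexity_bosLanguage (α : Type u) [Nonempty α] {p d L : ℕ} (hp : 2 ≤ p)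
    (hd : 1 ≤ d) (hL : 1 ≤ L) :
    (2 : ℕ∞) ^ p ≤ lengthComplexity bosLanguage (exactly (Option α) p d L) := by
  classical
  obtain ⟨a⟩ := ‹Nonempty α›
  refine le_lengthComplexity
    (uniformTransformer_mem_exactly hp hL fun h =>
      if (h ⟨0, hd⟩ : ℝ) < 0 then FixedPrecision.zero p p else fpRound p p 1)
    (uniformTransformer_mem_exactly hp hL fun _ => FixedPrecision.zero p p)
    -- The symbol in front adds one to the length, so `2 ^ p` letters already exceed the threshold
    -- and the bound `2 ^ p` is still reached.
    ⟨List.replicate (2 ^ p) a, ?_, ?_⟩ ?_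
  · rw [bosLanguage, Set.mem_ofPred_eq, mem_language_uniformTransformer]
    simp
  · simp [bosLanguage, language_uniformTransformer_zero]
  · rintro x ⟨hx, -⟩
    rw [bosLanguage, Set.mem_ofPred_eq, mem_language_uniformTransformer, List.length_cons,
      List.length_map] at hx
    exact_mod_cast Nat.lt_succ_iff.mp hx

end FPTransformer

end LowerBound

/-! ### The theorem. -/

theorem mainTheorem7 :
    ∃ (N : ℕ × ℕ × ℕ → ℕ) (Q : MvPolynomial (Fin 3) ℕ),
      Computable N ∧
      (∀ p d L : ℕ, N (p, d, L) ≤ 2 ^ MvPolynomial.eval ![p, d, L] Q) ∧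
      ∀ (α : Type u) [Finite α] [Nonempty α],
        -- the length complexity is at most exponential, and computably so
        (∀ p d L : ℕ,
          lengthComplexity FPTransformer.language (FPTransformer.atMost α p d L)
            ≤ (N (p, d, L) : ℕ∞) ∧
          lengthComplexity FPTransformer.bosLanguage (FPTransformer.atMost (Option α) p d L)
            ≤ (N (p, d, L) : ℕ∞)) ∧
        -- length generalization with the bound `N`
        (∀ p d L : ℕ,
          IsLengthGeneralizationBound FPTransformer.language
            (FPTransformer.atMost α p d L) (N (p, d, L)) ∧
          IsLengthGeneralizationBound FPTransformer.bosLanguage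
            (FPTransformer.atMost (Option α) p d L) (N (p, d, L))) ∧
        -- the length complexity is at least exponential
        (∀ p d L : ℕ, 2 ≤ p → 1 ≤ d → 1 ≤ L →
          (2 : ℕ∞) ^ p ≤
            lengthComplexity FPTransformer.language (FPTransformer.exactly α p d L) ∧
          (2 : ℕ∞) ^ p ≤
            lengthComplexity FPTransformer.bosLanguage
              (FPTransformer.exactly (Option α) p d L)) := by
  refine ⟨fun x => FPTransformer.lengthBound x.1 x.2.1 x.2.2,
    .X 0 * .X 1 + 2 * .X 0 + .X 2 + 1, FPTransformer.computable_lengthBound,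
    fun p d L => ?_, fun α _ _ => ⟨fun p d L => ⟨?_, ?_⟩, fun p d L => ⟨?_, ?_⟩,
      fun p d L hp hd hL =>
        ⟨FPTransformer.pow_le_lengthComplexity_language α hp hd hL,
          FPTransformer.pow_le_lengthComplexity_bosLanguage α hp hd hL⟩⟩⟩
  · simp [FPTransformer.lengthBound]
  · exact lengthComplexity_le_of_short fun E hE E' hE' x hx =>
      FPTransformer.exists_short_mem_language_diff hE hE' hx
  · exact lengthComplexity_le_of_short fun E hE E' hE' x hx =>
      FPTransformer.exists_short_mem_bosLanguage_diff hE hE' hx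
  · exact isLengthGeneralizationBound_of_short fun E hE E' hE' x hx =>
      FPTransformer.exists_short_mem_language_diff hE hE' hx
  · exact isLengthGeneralizationBound_of_short fun E hE E' hE' x hx =>
      FPTransformer.exists_short_mem_bosLanguage_diff hE hE' hx
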